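/- Let $(\Omega,\mathcal F,\mathbf P)$ be a probability space, let $n\ge 1$ be an integer and $T>0$. Let $X(t)$, $t\ge 0$, be a random process in $\mathbf R^n$ with right continuous paths with left limits, such that $X_i(t)\ge 0$ a.s. for all $t$ and $i$ and $\mathbf E\sup_{t\in[0,T]}|X(t)|^2<+\infty$, and let $\{\mathcal F_t\}_{t\ge 0}$ be the filtration generated by $X$. Let $\Gamma_0\subset\mathbf R^n$ be a closed convex cone such that (a) if $x_i\le\widehat x_i$ for all $i$ and $\widehat x\in\Gamma_0$, then $x\in\Gamma_0$; (b) for every $x\in\Gamma_0$ and $j\in\{1,\dots,n\}$ there is $M>0$ with $x+Me_j\notin\Gamma_0$, where $e_j$ is the $j$-th coordinate vector. Let $\widehat g\in\mathbf R^n$ have positive components and let $\Gamma=\Gamma_0+\widehat g$. Assume that one of the following two cases holds: 1. $K=[0,L]^n$ with $L>0$, and $f(x,u,t)=u^\top x$; 2. $K=\mathbf R^n$ and $f(x,u,t)=u^\top x-u^\top Gu$, where $G$ is a symmetric positive definite matrix. For a stopping time $t$ with values in $[0,T]$ and an $\mathcal F_t$-measurable random vector $Y$ with values in $\Gamma$,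 let $U(t,Y)$ be the set of jointly measurable processes $u(s)$, $s\in[t,T]$, with values in $K$, which are adapted to $\{\mathcal F_s\}$, have a.s. integrable paths, and satisfy $Y+\int_t^Tu(s)\,ds\in\Gamma$ a.s. For $u\in U(t,Y)$ let $F(u,t)=\int_t^Tf(X(s),u(s),s)\,ds$, which takes values in $[-\infty,+\infty)$ a.s. and has an integrable positive part, and let $$J(t,Y)=\operatorname*{ess\,sup}_{u\in U(t,Y)}\mathbf E\{F(u,t)\mid\mathcal F_t\}.$$ Then for every such pair $(t,Y)$ there exists an optimal control $\bar u\in U(t,Y)$, that is, a control $\bar u\in U(t,Y)$ such that $J(t,Y)=\mathbf E\{F(\bar u,t)\mid\mathcal F_t\}$ a.s. In particular, $\mathbf E F(u,t)\le\mathbf E F(\bar u,t)$ for every $u\in U(t,Y)$. -/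

import Mathlib

open MeasureTheory Matrix
open scoped NNReal ENNReal

namespace SwingControl

/-- The state space `ℝⁿ` with the Euclidean norm. -/
abbrev Vec (n : ℕ) : Type := EuclideanSpace ℝ (Fin n)

/-- A path which is right continuous and has (finite) left limits. -/
def IsRCLL {n : ℕ} (x : ℝ≥0 → Vec n) : Prop :=
  ∀ t : ℝ≥0, ContinuousWithinAt x (Set.Ici t) t ∧
    ∃ l : Vec n, Filter.Tendsto x (nhdsWithin t (Set.Iio t)) (nhds l)

/-- The conditions on `Γ₀`: a closed convex cone, downward closed for the componentwise order,
which every ray in a positive coordinate direction eventually leaves. -/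
structure IsConstraintCone {n : ℕ} (Γ₀ : Set (Vec n)) : Prop where
  isClosed : IsClosed Γ₀
  convex : Convex ℝ Γ₀
  smul_mem : ∀ c : ℝ, 0 < c → ∀ x ∈ Γ₀, c • x ∈ Γ₀
  mem_of_le : ∀ x x' : Vec n, (∀ i, x i ≤ x' i) → x' ∈ Γ₀ → x ∈ Γ₀
  exists_notMem : ∀ x ∈ Γ₀, ∀ j : Fin n, ∃ M : ℝ, 0 < M ∧ x + EuclideanSpace.single j M ∉ Γ₀

/-- The constraint set `Γ = Γ₀ + g`. -/
def constraintSet {n : ℕ} (Γ₀ : Set (Vec n)) (g : Vec n) : Set (Vec n) :=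
  {y | ∃ x ∈ Γ₀, y = x + g}

/-- The linear case: `K = [0,L]ⁿ` with `L > 0`, and `f(x,u,t) = uᵀx`. -/
def IsLinearCase {n : ℕ} (K : Set (Vec n)) (f : Vec n → Vec n → ℝ≥0 → ℝ) : Prop :=
  ∃ L : ℝ, 0 < L ∧ K = {v | ∀ i, 0 ≤ v i ∧ v i ≤ L} ∧
    ∀ x u t, f x u t = u.ofLp ⬝ᵥ x.ofLp

/-- The quadratic case: `K = ℝⁿ` and `f(x,u,t) = uᵀx - uᵀGu` with `G` symmetric and
positive definite. -/
def IsQuadraticCase {n : ℕ} (K : Set (Vec n)) (f : Vec n → Vec n → ℝ≥0 → ℝ) : Prop :=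
  ∃ G : Matrix (Fin n) (Fin n) ℝ, G.PosDef ∧ K = Set.univ ∧
    ∀ x u t, f x u t = u.ofLp ⬝ᵥ x.ofLp - u.ofLp ⬝ᵥ (G *ᵥ u.ofLp)

/-- The extended integral `∫ g⁺ - ∫ g⁻` of an extended real function. It is the usual one whenever
`∫ g⁺` or `∫ g⁻` is finite (in `EReal`, `⊤ - ⊤ = ⊥`). -/
noncomputable def extIntegral {α : Type*} [MeasurableSpace α] (μ : Measure α) (g : α → EReal) :
    EReal :=
  ((∫⁻ a, (g a).toENNReal ∂μ : ℝ≥0∞) : EReal) - ((∫⁻ a, (-g a).toENNReal ∂μ : ℝ≥0∞) : EReal)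

/-- The extended conditional expectation `E[g⁺ | m] - E[g⁻ | m]` of an extended real random
variable, the two terms being conditional expectations of `[0,∞]`-valued functions. It is the usual
one whenever `g⁺` or `g⁻` is integrable. -/
noncomputable def extCondExp {Ω : Type*} {mΩ : MeasurableSpace Ω} (m : MeasurableSpace Ω)
    (P : Measure[mΩ] Ω) (g : Ω → EReal) : Ω → EReal := fun ω =>
  ((condLExp m P (fun ω' => (g ω').toENNReal) ω : ℝ≥0∞) : EReal) -
    ((condLExp m P (fun ω' => (-g ω').toENNReal) ω : ℝ≥0∞) : EReal)

/-- `g` is (a version of) the essential supremum of the family `S` of random variables. -/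
structure IsEssSupFamily {Ω : Type*} {mΩ : MeasurableSpace Ω} (P : Measure Ω)
    (S : Set (Ω → EReal)) (g : Ω → EReal) : Prop where
  measurable : Measurable g
  upper : ∀ h ∈ S, h ≤ᵐ[P] g
  least : ∀ g' : Ω → EReal, Measurable g' → (∀ h ∈ S, h ≤ᵐ[P] g') → g ≤ᵐ[P] g'

section Control

variable {Ω : Type*} {mΩ : MeasurableSpace Ω} {n : ℕ}

/-- The set `U(τ,Y)` of admissible controls. A control is a process `u(s,ω)`,
`τ(ω) ≤ s ≤ T`, with values in `K`, jointly measurable and adapted; its values for other `s` are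
irrelevant. Its paths are integrable on `[τ,T]` and `Y + ∫_τ^T u(s) ds ∈ Γ` almost surely. -/
structure IsAdmissible (P : Measure Ω) (𝓕 : Filtration ℝ≥0 mΩ) (T : ℝ≥0) (Γ K : Set (Vec n))
    (τ : Ω → ℝ≥0) (Y : Ω → Vec n) (u : ℝ≥0 → Ω → Vec n) : Prop where
  mem : ∀ ω s, τ ω ≤ s → s ≤ T → u s ω ∈ K
  measurable : Measurable
    ({p : ℝ≥0 × Ω | τ p.2 ≤ p.1 ∧ p.1 ≤ T}.indicator (fun p => u p.1 p.2))
  adapted : ∀ s ≤ T, Measurable[𝓕 s] ({ω | τ ω ≤ s}.indicator (u s))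
  integrableOn : ∀ᵐ ω ∂P,
    IntegrableOn (fun s : ℝ => u s.toNNReal ω) (Set.Icc (τ ω : ℝ) (T : ℝ))
  constraint : ∀ᵐ ω ∂P,
    (Y ω + ∫ s in Set.Icc (τ ω : ℝ) (T : ℝ), u s.toNNReal ω) ∈ Γ

/-- The payoff `F(u,τ) = ∫_τ^T f(X(s),u(s),s) ds`, an extended real random variable. -/
noncomputable def payoff (f : Vec n → Vec n → ℝ≥0 → ℝ) (X : ℝ≥0 → Ω → Vec n) (T : ℝ≥0)
    (τ : Ω → ℝ≥0) (u : ℝ≥0 → Ω → Vec n) : Ω → EReal := fun ω =>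
  extIntegral (volume.restrict (Set.Icc (τ ω : ℝ) (T : ℝ)))
    (fun s : ℝ => ((f (X s.toNNReal ω) (u s.toNNReal ω) s.toNNReal : ℝ) : EReal))

end Control

end SwingControl

/-!
In both cases the running payoff satisfies `f(x,u,s) + c ‖u‖² ≤ C (1 + ‖x‖²)`, so that maximizing
the payoff means minimizing the nonnegative loss `C (1 + ‖x‖²) - f(x,u,s)`, and controls of bounded
expected loss are bounded in `L²` of the stochastic interval `[τ,T]`. Since `f` is concave in `u`,
the sets of almost minimizing controls are convex; as they decrease, their closures in `L²` have a
common point, which is the limit of a minimizing sequence. By Fatou's lemma the limit has minimal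
expected loss, and since almost every path converges in `L¹`, it satisfies the constraint.

A control which is optimal in expectation is optimal conditionally on `𝓕_τ`: two controls can be
pasted together along any event of `𝓕_τ`, so the optimal one wins on each of these events.
-/

namespace SwingControl

open Filter Topology Set

section ExtendedReal

theorem coe_sub_coe_eq_coe_sub_coe {a b c d : ℝ≥0∞} (ha : a ≠ ∞) (hc : c ≠ ∞)
    (h : a + d = c + b) : (a : EReal) - b = c - d := by
  by_cases hb : b = ∞
  · have hd : d = ∞ := by simpa [hb, ha] using h
    rw [hb, hd, EReal.coe_ennreal_top, EReal.sub_top, EReal.sub_top]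
  · have hd : d ≠ ∞ := fun hd => ENNReal.add_ne_top.2 ⟨hc, hb⟩ (by rw [← h, hd, add_top])
    lift a to ℝ≥0 using ha
    lift b to ℝ≥0 using hb
    lift c to ℝ≥0 using hc
    lift d to ℝ≥0 using hd
    have h' : (a : ℝ) + d = c + b := by exact_mod_cast h
    exact congrArg Real.toEReal (show (a : ℝ) - b = c - d by linarith)

theorem toENNReal_coe_sub_coe (a b : ℝ≥0∞) : ((a : EReal) - b).toENNReal = a - b := by
  rw [EReal.toENNReal_sub (EReal.coe_ennreal_nonneg b), EReal.toENNReal_coe, EReal.toENNReal_coe]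

theorem toENNReal_neg_coe_sub_coe {a : ℝ≥0∞} (b : ℝ≥0∞) (ha : a ≠ ∞) :
    (-((a : EReal) - b)).toENNReal = b - a := by
  rw [EReal.neg_sub (.inl (EReal.coe_ennreal_ne_bot a))
    (.inl (EReal.coe_ennreal_eq_top_iff.not.2 ha)), add_comm, ← sub_eq_add_neg,
    toENNReal_coe_sub_coe]

theorem coe_sub_coe_eq_ite (a b : ℝ≥0∞) : (a : EReal) - b =
    if b = ∞ then ⊥ else if a = ∞ then ⊤ else ((a.toReal - b.toReal : ℝ) : EReal) := by
  split_ifs with hb ha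
  · rw [hb, EReal.coe_ennreal_top, EReal.sub_top]
  · lift b to ℝ≥0 using hb
    rw [ha]
    exact EReal.top_sub_coe _
  · lift a to ℝ≥0 using ha
    lift b to ℝ≥0 using hb
    rfl

theorem measurable_coe_sub_coe : Measurable fun p : ℝ≥0∞ × ℝ≥0∞ => (p.1 : EReal) - p.2 := by
  simp only [coe_sub_coe_eq_ite]
  exact Measurable.ite (measurable_snd (measurableSet_singleton _)) measurable_const
    (Measurable.ite (measurable_fst (measurableSet_singleton _)) measurable_const (by fun_prop))

end ExtendedReal

section ExtendedIntegral

variable {α : Type*} {mα : MeasurableSpace α} {μ : Measure α}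

theorem extIntegral_congr_ae {g g' : α → EReal} (h : g =ᵐ[μ] g') :
    extIntegral μ g = extIntegral μ g' :=
  congrArg₂ (fun a b : ℝ≥0∞ => (a : EReal) - b)
    (lintegral_congr_ae (h.fun_comp EReal.toENNReal))
    (lintegral_congr_ae (h.fun_comp fun x => (-x).toENNReal))

theorem extCondExp_congr_ae (m : MeasurableSpace α) {g g' : α → EReal} (h : g =ᵐ[μ] g') :
    extCondExp m μ g =ᵐ[μ] extCondExp m μ g' := by
  filter_upwards [condLExp_congr_ae (mΩ := m) (h.fun_comp EReal.toENNReal),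
    condLExp_congr_ae (mΩ := m) (h.fun_comp fun x => (-x).toENNReal)] with a hpos hneg
  exact congrArg₂ (fun a b : ℝ≥0∞ => (a : EReal) - b) hpos hneg

theorem measurable_extCondExp (m : MeasurableSpace α) (g : α → EReal) :
    Measurable[m] (extCondExp m μ g) :=
  measurable_coe_sub_coe.comp ((measurable_condLExp m μ _).prodMk (measurable_condLExp m μ _))

variable {d h : α → ℝ≥0∞}

theorem toENNReal_add_eq_add_toENNReal_neg_ae (hd : ∀ᵐ a ∂μ, d a ≠ ∞) :
    (fun a => ((d a : EReal) - h a).toENNReal) + h =ᵐ[μ]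
      d + fun a => (-((d a : EReal) - h a)).toENNReal := by
  filter_upwards [hd] with a ha
  rw [Pi.add_apply, Pi.add_apply, toENNReal_coe_sub_coe, toENNReal_neg_coe_sub_coe _ ha,
    tsub_add_eq_max, add_tsub_eq_max]

theorem lintegral_toENNReal_coe_sub_coe_ne_top (hfin : ∫⁻ a, d a ∂μ ≠ ∞) :
    ∫⁻ a, ((d a : EReal) - h a).toENNReal ∂μ ≠ ∞ :=
  ne_top_of_le_ne_top hfin <| lintegral_mono fun a =>
    (toENNReal_coe_sub_coe (d a) (h a)).trans_le tsub_le_self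

theorem aemeasurable_toENNReal_coe_sub_coe (hd : AEMeasurable d μ) (hh : AEMeasurable h μ) :
    AEMeasurable (fun a => ((d a : EReal) - h a).toENNReal) μ := by
  simp only [toENNReal_coe_sub_coe]
  exact hd.sub hh

theorem extIntegral_coe_sub_coe (hd : AEMeasurable d μ) (hh : AEMeasurable h μ)
    (hfin : ∫⁻ a, d a ∂μ ≠ ∞) :
    extIntegral μ (fun a => (d a : EReal) - h a) =
      ((∫⁻ a, d a ∂μ : ℝ≥0∞) : EReal) - (∫⁻ a, h a ∂μ : ℝ≥0∞) := by
  refine coe_sub_coe_eq_coe_sub_coe (lintegral_toENNReal_coe_sub_coe_ne_top hfin) hfin ?_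
  rw [← lintegral_add_left' (aemeasurable_toENNReal_coe_sub_coe hd hh), ← lintegral_add_left' hd]
  exact lintegral_congr_ae
    (toENNReal_add_eq_add_toENNReal_neg_ae ((ae_lt_top' hd hfin).mono fun _ ha => ha.ne))

theorem extCondExp_coe_sub_coe (m : MeasurableSpace α) (hd : AEMeasurable d μ)
    (hh : AEMeasurable h μ) (hfin : ∫⁻ a, d a ∂μ ≠ ∞) :
    extCondExp m μ (fun a => (d a : EReal) - h a) =ᵐ[μ]
      fun a => (condLExp m μ d a : EReal) - condLExp m μ h a := by
  filter_upwards [condLExp_ne_top (mΩ := m) hfin,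
    condLExp_ne_top (mΩ := m) (lintegral_toENNReal_coe_sub_coe_ne_top (h := h) hfin),
    condLExp_congr_ae (mΩ := m) (toENNReal_add_eq_add_toENNReal_neg_ae (h := h)
      ((ae_lt_top' hd hfin).mono fun _ ha => ha.ne)),
    condLExp_add_left (mΩ := m) h (aemeasurable_toENNReal_coe_sub_coe hd hh),
    condLExp_add_left (mΩ := m) (fun a => (-((d a : EReal) - h a)).toENNReal) hd]
    with a hd_top hg_top hcongr hadd hadd'
  exact coe_sub_coe_eq_coe_sub_coe hg_top hd_top (by simpa [hadd, hadd'] using hcongr)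

theorem condLExp_le_condLExp_of_forall_setLIntegral_le {m : MeasurableSpace α} (hm : m ≤ mα)
    [SigmaFinite (μ.trim hm)]
    (hle : ∀ s, MeasurableSet[m] s → ∫⁻ a in s, d a ∂μ ≤ ∫⁻ a in s, h a ∂μ) :
    condLExp m μ d ≤ᵐ[μ] condLExp m μ h := by
  refine ae_le_of_ae_le_trim (hm := hm) ?_
  refine ae_le_of_forall_setLIntegral_le_of_sigmaFinite (measurable_condLExp m μ d) ?_
  intro s hs _
  rw [setLIntegral_condLExp_trim hm μ d hs, setLIntegral_condLExp_trim hm μ h hs]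
  exact hle s hs

end ExtendedIntegral

section HilbertSpace

variable {E : Type*} [NormedAddCommGroup E] [InnerProductSpace ℝ E]

theorem exists_mem_forall_norm_sub_sq_le [CompleteSpace E] {S : Set E} (hne : S.Nonempty)
    (hcl : IsClosed S) (hS : Convex ℝ S) :
    ∃ x ∈ S, ∀ y ∈ S, ‖y - x‖ ^ 2 ≤ ‖y‖ ^ 2 - ‖x‖ ^ 2 := by
  obtain ⟨x, hx, hmin⟩ := exists_norm_eq_iInf_of_complete_convex hne hcl.isComplete hS 0
  refine ⟨x, hx, fun y hy => ?_⟩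
  have hinner := (norm_eq_iInf_iff_real_inner_le_zero hS hx).1 hmin y hy
  rw [zero_sub, inner_neg_left, inner_sub_right, real_inner_self_eq_norm_sq] at hinner
  rw [norm_sub_sq_real, real_inner_comm]
  linarith

theorem nonempty_iInter_of_antitone_convex [CompleteSpace E] {S : ℕ → Set E} (hanti : Antitone S)
    (hne : ∀ k, (S k).Nonempty) (hcl : ∀ k, IsClosed (S k)) (hS : ∀ k, Convex ℝ (S k))
    (hbdd : Bornology.IsBounded (S 0)) : (⋂ k, S k).Nonempty := by
  choose x hxS hx using fun k => exists_mem_forall_norm_sub_sq_le (hne k) (hcl k) (hS k)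
  obtain ⟨R, hR⟩ := hbdd.exists_norm_le
  have hdist : ∀ k l, k ≤ l → ‖x l - x k‖ ^ 2 ≤ ‖x l‖ ^ 2 - ‖x k‖ ^ 2 :=
    fun k l hkl => hx k _ (hanti hkl (hxS l))
  have hmono : Monotone fun k => ‖x k‖ ^ 2 := fun k l hkl =>
    sub_nonneg.1 ((sq_nonneg _).trans (hdist k l hkl))
  have hbound : BddAbove (range fun k => ‖x k‖ ^ 2) := ⟨R ^ 2, forall_mem_range.2 fun k =>
    pow_le_pow_left₀ (norm_nonneg _) (hR _ (hanti zero_le (hxS k))) 2⟩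
  have hlim := tendsto_atTop_ciSup hmono hbound
  have hcauchy : CauchySeq x := by
    refine cauchySeq_of_le_tendsto_0' (fun k => √((⨆ l, ‖x l‖ ^ 2) - ‖x k‖ ^ 2)) ?_ ?_
    · intro k l hkl
      rw [dist_comm, dist_eq_norm]
      exact Real.le_sqrt_of_sq_le ((hdist k l hkl).trans (by gcongr; exact le_ciSup hbound l))
    · have hsqrt := ((tendsto_const_nhds (x := ⨆ l, ‖x l‖ ^ 2)).sub hlim).sqrt
      rwa [sub_self, Real.sqrt_zero] at hsqrt
  obtain ⟨y, hy⟩ := cauchySeq_tendsto_of_complete hcauchy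
  exact ⟨y, mem_iInter.2 fun k => (hcl k).mem_of_tendsto hy
    (eventually_atTop.2 ⟨k, fun l hkl => hanti hkl (hxS l)⟩)⟩

end HilbertSpace

section SquareIntegrable

variable {α E : Type*} {mα : MeasurableSpace α} {μ : Measure α} [NormedAddCommGroup E]

theorem eLpNorm_two_sq (x : α → E) : eLpNorm x 2 μ ^ 2 = ∫⁻ a, ‖x a‖ₑ ^ 2 ∂μ := by
  simpa using eLpNorm_nnreal_pow_eq_lintegral (f := x) (μ := μ) (p := 2) two_ne_zero

theorem lintegral_enorm_sq_le {x : α → E} (hx : AEStronglyMeasurable x μ) :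
    (∫⁻ a, ‖x a‖ₑ ∂μ) ^ 2 ≤ (∫⁻ a, ‖x a‖ₑ ^ 2 ∂μ) * μ univ := by
  have hle := eLpNorm_le_eLpNorm_mul_rpow_measure_univ (p := 1) (q := 2) one_le_two hx
  calc (∫⁻ a, ‖x a‖ₑ ∂μ) ^ 2
      ≤ (eLpNorm x 2 μ * μ univ ^ (1 / (1 : ℝ≥0∞).toReal - 1 / (2 : ℝ≥0∞).toReal)) ^ 2 := by
        rw [← eLpNorm_one_eq_lintegral_enorm]
        exact pow_le_pow_left' hle 2
    _ = (∫⁻ a, ‖x a‖ₑ ^ 2 ∂μ) * μ univ := by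
        rw [mul_pow, eLpNorm_two_sq, ← ENNReal.rpow_natCast, ← ENNReal.rpow_mul]
        norm_num

theorem ae_tendsto_zero_of_tsum_lintegral_ne_top {q : ℕ → α → ℝ≥0∞}
    (hq : ∀ k, AEMeasurable (q k) μ) (hsum : ∑' k, ∫⁻ a, q k a ∂μ ≠ ∞) :
    ∀ᵐ a ∂μ, Tendsto (fun k => q k a) atTop (𝓝 0) := by
  rw [← lintegral_tsum hq] at hsum
  filter_upwards [ae_lt_top' (AEMeasurable.tsum hq) hsum] with a ha
  exact ENNReal.tendsto_atTop_zero_of_tsum_ne_top ha.ne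

theorem tendsto_zero_of_tendsto_sq_zero {x : ℕ → ℝ≥0∞}
    (h : Tendsto (fun k => x k ^ 2) atTop (𝓝 0)) : Tendsto x atTop (𝓝 0) := by
  have hsqrt := (ENNReal.continuous_rpow_const (y := 1 / 2)).tendsto 0 |>.comp h
  simp only [Function.comp_def, ← ENNReal.rpow_natCast, ← ENNReal.rpow_mul] at hsqrt
  simpa using hsqrt

theorem ae_tendsto_of_tsum_lintegral_enorm_sub_sq_ne_top {w : ℕ → α → E} {x : α → E}
    (hw : ∀ k, AEStronglyMeasurable (w k) μ) (hx : AEStronglyMeasurable x μ)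
    (hsum : ∑' k, ∫⁻ a, ‖w k a - x a‖ₑ ^ 2 ∂μ ≠ ∞) :
    ∀ᵐ a ∂μ, Tendsto (fun k => w k a) atTop (𝓝 (x a)) := by
  filter_upwards [ae_tendsto_zero_of_tsum_lintegral_ne_top
    (fun k => ((hw k).sub hx).enorm.pow_const 2) hsum] with a ha
  simpa only [tendsto_iff_edist_tendsto_0, edist_eq_enorm_sub, Pi.sub_apply] using
    tendsto_zero_of_tendsto_sq_zero ha

theorem lintegral_le_of_ae_tendsto {q : ℕ → α → ℝ≥0∞} {q' : α → ℝ≥0∞} {c : ℝ≥0∞}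
    (hq : ∀ k, AEMeasurable (q k) μ) (hlim : ∀ᵐ a ∂μ, Tendsto (fun k => q k a) atTop (𝓝 (q' a)))
    (hc : Tendsto (fun k => ∫⁻ a, q k a ∂μ) atTop (𝓝 c)) : ∫⁻ a, q' a ∂μ ≤ c :=
  calc ∫⁻ a, q' a ∂μ = ∫⁻ a, liminf (fun k => q k a) atTop ∂μ :=
        lintegral_congr_ae (hlim.mono fun _ ha => ha.liminf_eq.symm)
    _ ≤ liminf (fun k => ∫⁻ a, q k a ∂μ) atTop := lintegral_liminf_le' hq
    _ = c := hc.liminf_eq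

theorem integrable_of_tendsto_lintegral_enorm_sub {w : ℕ → α → E} {x : α → E}
    (hw : ∀ k, Integrable (w k) μ) (hx : AEStronglyMeasurable x μ)
    (h : Tendsto (fun k => ∫⁻ a, ‖w k a - x a‖ₑ ∂μ) atTop (𝓝 0)) : Integrable x μ := by
  obtain ⟨k, hk⟩ := (h.eventually_lt_const ENNReal.zero_lt_top).exists
  have hsub : Integrable (w k - x) μ := ⟨(hw k).1.sub hx, hk⟩
  simpa using (hw k).sub hsub

theorem convex_setOf_exists_ae_eq [NormedSpace ℝ E] {p : ℝ≥0∞} {V : Set (α → E)}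
    (hV : Convex ℝ V) : Convex ℝ {f : Lp E p μ | ∃ u ∈ V, f =ᵐ[μ] u} := by
  rintro f ⟨u, hu, hfu⟩ g ⟨v, hv, hgv⟩ a b ha hb hab
  refine ⟨a • u + b • v, hV hu hv ha hb hab, ?_⟩
  filter_upwards [Lp.coeFn_add (a • f) (b • g), Lp.coeFn_smul a f, Lp.coeFn_smul b g, hfu, hgv]
    with x hadd hsmul hsmul' hf hg
  rw [hadd, Pi.add_apply, hsmul, hsmul', Pi.smul_apply, Pi.smul_apply, hf, hg]
  rfl

variable [InnerProductSpace ℝ E] [CompleteSpace E]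

theorem exists_seq_mem_tsum_lintegral_sub_ne_top {V : ℕ → Set (α → E)} (hanti : Antitone V)
    (hne : ∀ k, (V k).Nonempty) (hV : ∀ k, Convex ℝ (V k))
    (hmeas : ∀ u ∈ V 0, AEStronglyMeasurable u μ) {R : ℝ≥0∞} (hR : R ≠ ∞)
    (hbdd : ∀ u ∈ V 0, ∫⁻ a, ‖u a‖ₑ ^ 2 ∂μ ≤ R) :
    ∃ (u : ℕ → α → E) (x : α → E), (∀ k, u k ∈ V k) ∧ AEStronglyMeasurable x μ ∧
      ∑' k, ∫⁻ a, ‖u k a - x a‖ₑ ^ 2 ∂μ ≠ ∞ := by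
  set S : ℕ → Set (Lp E 2 μ) := fun k => {f | ∃ u ∈ V k, f =ᵐ[μ] u}
  have hle : ∀ u ∈ V 0, eLpNorm u 2 μ ^ 2 ≤ R := fun u hu => (eLpNorm_two_sq u).trans_le (hbdd u hu)
  have hSne : ∀ k, (S k).Nonempty := fun k => by
    obtain ⟨u, hu⟩ := hne k
    have hu₀ := hanti zero_le hu
    have hLp : MemLp u 2 μ := ⟨hmeas u hu₀, lt_top_iff_ne_top.2 fun htop =>
      hR (top_le_iff.1 (by simpa [htop] using hle u hu₀))⟩
    exact ⟨hLp.toLp u, u, hu, hLp.coeFn_toLp⟩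
  have hSbdd : Bornology.IsBounded (closure (S 0)) := by
    refine (isBounded_iff_forall_norm_le.2 ⟨√R.toReal, ?_⟩).closure
    rintro f ⟨u, hu, hfu⟩
    refine Real.le_sqrt_of_sq_le ?_
    rw [Lp.norm_def, eLpNorm_congr_ae hfu, ← ENNReal.toReal_pow]
    exact ENNReal.toReal_mono hR (hle u hu)
  obtain ⟨x, hx⟩ := nonempty_iInter_of_antitone_convex
    (S := fun k => closure (S k))
    (fun k l hkl => closure_mono fun _ ⟨u, hu, hfu⟩ => ⟨u, hanti hkl hu, hfu⟩)
    (fun k => (hSne k).closure) (fun k => isClosed_closure)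
    (fun k => (convex_setOf_exists_ae_eq (hV k)).closure) hSbdd
  have hclose : ∀ k, ∃ f ∈ S k, edist x f < 2⁻¹ ^ k := fun k =>
    EMetric.mem_closure_iff.1 (mem_iInter.1 hx k) _ (ENNReal.pow_pos (by simp) k)
  choose f hf hdist using hclose
  choose u hu hfu using hf
  refine ⟨u, x, hu, Lp.aestronglyMeasurable x, ?_⟩
  have hgeom : ∑' k : ℕ, (2⁻¹ : ℝ≥0∞) ^ k ≠ ∞ := by simp [ENNReal.tsum_geometric]
  refine ne_top_of_le_ne_top hgeom (ENNReal.tsum_le_tsum fun k => ?_)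
  calc ∫⁻ a, ‖u k a - x a‖ₑ ^ 2 ∂μ = edist x (f k) ^ 2 := by
        rw [edist_comm, Lp.edist_def, eLpNorm_congr_ae ((hfu k).sub .rfl), eLpNorm_two_sq]
        rfl
    _ ≤ (2⁻¹ ^ k) ^ 2 := by gcongr; exact (hdist k).le
    _ ≤ 2⁻¹ ^ k := pow_le_of_le_one zero_le (pow_le_one₀ zero_le (by simp)) two_ne_zero

theorem exists_minimizing_seq_of_quasiconvexOn {U : Set (α → E)} {J : (α → E) → ℝ≥0∞}
    (hJ : QuasiconvexOn ℝ U J) (hU : ∀ u ∈ U, AEStronglyMeasurable u μ) {A : ℝ≥0∞} (hA : A ≠ ∞)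
    (hcoer : ∀ u ∈ U, ∫⁻ a, ‖u a‖ₑ ^ 2 ∂μ ≤ A * J u) (hfin : ∃ u ∈ U, J u ≠ ∞) :
    ∃ (u : ℕ → α → E) (x : α → E), (∀ k, u k ∈ U) ∧
      Tendsto (fun k => J (u k)) atTop (𝓝 (⨅ v ∈ U, J v)) ∧ AEStronglyMeasurable x μ ∧
      ∑' k, ∫⁻ a, ‖u k a - x a‖ₑ ^ 2 ∂μ ≠ ∞ := by
  set m := ⨅ v ∈ U, J v with hm
  have hm_top : m ≠ ∞ := by
    obtain ⟨u, hu, hJu⟩ := hfin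
    exact ne_top_of_le_ne_top hJu (iInf₂_le u hu)
  set ε : ℕ → ℝ≥0∞ := fun k => ((k + 1 : ℕ) : ℝ≥0∞)⁻¹ with hε
  have hε_anti : Antitone ε := fun k l hkl => ENNReal.inv_le_inv.2 (by gcongr)
  have hε_lim : Tendsto (fun k => m + ε k) atTop (𝓝 m) := by
    simpa [hε] using (tendsto_const_nhds (x := m)).add
      (ENNReal.tendsto_inv_nat_nhds_zero.comp (tendsto_add_atTop_nat 1))
  obtain ⟨u, x, hu, hx, hsum⟩ := exists_seq_mem_tsum_lintegral_sub_ne_top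
    (V := fun k => {u | u ∈ U ∧ J u ≤ m + ε k}) (R := A * (m + ε 0))
    (fun k l hkl u hu => ⟨hu.1, hu.2.trans (by gcongr; exact hε_anti hkl)⟩)
    (fun k => by
      have hlt : m < m + ε k := ENNReal.lt_add_right hm_top (by simp [hε])
      obtain ⟨u, hu, hJu⟩ := by simpa only [hm, iInf_lt_iff, exists_prop] using hlt
      exact ⟨u, hu, hJu.le⟩)
    (fun k => hJ _) (fun u hu => hU u hu.1)
    (ENNReal.mul_ne_top hA (ENNReal.add_ne_top.2 ⟨hm_top, by simp [hε]⟩))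
    (fun u hu => (hcoer u hu.1).trans (by gcongr; exact hu.2))
  exact ⟨u, x, fun k => (hu k).1, tendsto_of_tendsto_of_tendsto_of_le_of_le tendsto_const_nhds
    hε_lim (fun k => iInf₂_le _ (hu k).1) (fun k => (hu k).2), hx, hsum⟩

end SquareIntegrable

section PointwiseLimit

open Classical in
/-- The limit of a sequence, or `0` if the sequence diverges. Unlike `limUnder`, it stays in every
closed set which contains the sequence and `0`, whether or not the sequence converges. -/
noncomputable def limOrZero {E : Type*} [TopologicalSpace E] [Zero E] (x : ℕ → E) : E :=
  if ∃ l, Tendsto x atTop (𝓝 l) then limUnder atTop x else 0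

variable {E : Type*} [TopologicalSpace E] [Zero E]

theorem limOrZero_eq [T2Space E] {x : ℕ → E} {l : E} (h : Tendsto x atTop (𝓝 l)) :
    limOrZero x = l := by
  rw [limOrZero, if_pos ⟨l, h⟩, h.limUnder_eq]

theorem limOrZero_mem {K : Set E} (hK : IsClosed K) (h₀ : (0 : E) ∈ K) {x : ℕ → E}
    (hx : ∀ k, x k ∈ K) : limOrZero x ∈ K := by
  rw [limOrZero]
  split_ifs with h
  · exact hK.mem_of_tendsto (tendsto_nhds_limUnder h) (.of_forall hx)
  · exact h₀

theorem indicator_limOrZero [T2Space E] {α : Type*} (A : Set α) (w : ℕ → α → E) :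
    A.indicator (fun a => limOrZero fun k => w k a) =
      fun a => limOrZero fun k => A.indicator (w k) a := by
  funext a
  by_cases ha : a ∈ A
  · simp only [indicator_of_mem ha]
  · simp only [indicator_of_notMem ha]
    exact (limOrZero_eq tendsto_const_nhds).symm

theorem measurable_limOrZero [PolishSpace E] [MeasurableSpace E] [BorelSpace E] {α : Type*}
    {_ : MeasurableSpace α} {w : ℕ → α → E} (hw : ∀ k, Measurable (w k)) :
    Measurable fun a => limOrZero fun k => w k a :=
  Measurable.ite (measurableSet_exists_tendsto hw)
    (StronglyMeasurable.limUnder fun k => (hw k).stronglyMeasurable).measurable measurable_const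

end PointwiseLimit

section StochasticInterval

variable {Ω : Type*} {mΩ : MeasurableSpace Ω}

/-- The stochastic interval `[τ, T]`, as a set of pairs `(ω, s)`. Time is real here, so that the
sections carry Lebesgue measure. -/
def stochasticInterval (τ : Ω → ℝ≥0) (T : ℝ≥0) : Set (Ω × ℝ) :=
  {p | p.2 ∈ Icc (τ p.1 : ℝ) T}

/-- The product measure `P ⊗ ds` on the stochastic interval `[τ, T]`, on which controls are
regarded as square integrable functions. -/
noncomputable def controlMeasure (P : Measure Ω) (τ : Ω → ℝ≥0) (T : ℝ≥0) : Measure (Ω × ℝ) :=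
  (P.prod volume).restrict (stochasticInterval τ T)

/-- The integral `∫_τ^T q(ω, s) ds`, as a random variable. -/
noncomputable def timeIntegral (τ : Ω → ℝ≥0) (T : ℝ≥0) (q : Ω × ℝ → ℝ≥0∞) (ω : Ω) : ℝ≥0∞ :=
  ∫⁻ s in Icc (τ ω : ℝ) T, q (ω, s)

/-- A process, indexed by `ℝ≥0`, as a function on `Ω × ℝ`. -/
def uncurryReal {E : Type*} (u : ℝ≥0 → Ω → E) (p : Ω × ℝ) : E :=
  u p.2.toNNReal p.1

variable {P : Measure Ω} {τ : Ω → ℝ≥0} {T : ℝ≥0}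

theorem measurableSet_stochasticInterval (hτ : Measurable τ) :
    MeasurableSet (stochasticInterval τ T) := by
  have hle : MeasurableSet {p : Ω × ℝ | (τ p.1 : ℝ) ≤ p.2} :=
    measurableSet_le (by fun_prop) (by fun_prop)
  exact hle.inter (measurable_snd measurableSet_Iic)

theorem toNNReal_mem_Icc {a b : ℝ≥0} {s : ℝ} (hs : s ∈ Icc (a : ℝ) b) : s.toNNReal ∈ Icc a b :=
  ⟨NNReal.le_toNNReal_of_coe_le hs.1, Real.toNNReal_le_iff_le_coe.2 hs.2⟩

theorem ae_controlMeasure_of_forall (hτ : Measurable τ) {Q : Ω × ℝ → Prop}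
    (h : ∀ p ∈ stochasticInterval τ T, Q p) : ∀ᵐ p ∂controlMeasure P τ T, Q p :=
  (ae_restrict_iff' (measurableSet_stochasticInterval hτ)).2 (.of_forall h)

instance [IsFiniteMeasure P] : IsFiniteMeasure (controlMeasure P τ T) where
  measure_univ_lt_top := by
    rw [controlMeasure, Measure.restrict_apply_univ]
    calc (P.prod volume) (stochasticInterval τ T)
        ≤ (P.prod volume) (univ ×ˢ Icc (0 : ℝ) T) :=
          measure_mono fun p hp => ⟨mem_univ _, (τ p.1).coe_nonneg.trans hp.1, hp.2⟩
      _ < ∞ := by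
        rw [Measure.prod_prod]
        exact ENNReal.mul_lt_top (measure_lt_top P _) measure_Icc_lt_top

theorem ae_ae_of_ae_controlMeasure (hτ : Measurable τ) {Q : Ω × ℝ → Prop}
    (h : ∀ᵐ p ∂controlMeasure P τ T, Q p) :
    ∀ᵐ ω ∂P, ∀ᵐ s ∂volume.restrict (Icc (τ ω : ℝ) T), Q (ω, s) := by
  filter_upwards [Measure.ae_ae_of_ae_prod
    ((ae_restrict_iff' (measurableSet_stochasticInterval hτ)).1 h)] with ω hω
  exact (ae_restrict_iff' measurableSet_Icc).2 hω

theorem ae_aestronglyMeasurable_slice {E : Type*} [TopologicalSpace E] (hτ : Measurable τ)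
    {x : Ω × ℝ → E} (hx : AEStronglyMeasurable x (controlMeasure P τ T)) :
    ∀ᵐ ω ∂P, AEStronglyMeasurable (fun s => x (ω, s)) (volume.restrict (Icc (τ ω : ℝ) T)) := by
  filter_upwards [ae_ae_of_ae_controlMeasure hτ hx.ae_eq_mk] with ω hω
  exact ⟨_, hx.stronglyMeasurable_mk.comp_measurable measurable_prodMk_left, hω⟩

theorem lintegral_indicator_stochasticInterval (q : Ω × ℝ → ℝ≥0∞) (ω : Ω) :
    ∫⁻ s, (stochasticInterval τ T).indicator q (ω, s) = timeIntegral τ T q ω := by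
  rw [timeIntegral, ← lintegral_indicator measurableSet_Icc]
  rfl

variable {q : Ω × ℝ → ℝ≥0∞}

theorem aemeasurable_timeIntegral (hτ : Measurable τ) (hq : AEMeasurable q (controlMeasure P τ T)) :
    AEMeasurable (timeIntegral τ T q) P := by
  simpa only [lintegral_indicator_stochasticInterval] using AEMeasurable.lintegral_prod_right'
    ((aemeasurable_indicator_iff (measurableSet_stochasticInterval hτ)).2 hq)

theorem lintegral_controlMeasure (hτ : Measurable τ) (hq : AEMeasurable q (controlMeasure P τ T)) :
    ∫⁻ p, q p ∂controlMeasure P τ T = ∫⁻ ω, timeIntegral τ T q ω ∂P := by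
  have hS := measurableSet_stochasticInterval (T := T) hτ
  rw [controlMeasure, ← lintegral_indicator hS,
    lintegral_prod _ ((aemeasurable_indicator_iff hS).2 hq)]
  simp only [lintegral_indicator_stochasticInterval]

theorem ae_tendsto_timeIntegral_enorm_sub {E : Type*} [NormedAddCommGroup E] (hτ : Measurable τ)
    {w : ℕ → Ω × ℝ → E} {x : Ω × ℝ → E}
    (hw : ∀ k, AEStronglyMeasurable (w k) (controlMeasure P τ T))
    (hx : AEStronglyMeasurable x (controlMeasure P τ T))
    (hsum : ∑' k, ∫⁻ p, ‖w k p - x p‖ₑ ^ 2 ∂controlMeasure P τ T ≠ ∞) :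
    ∀ᵐ ω ∂P, Tendsto (fun k => timeIntegral τ T (fun p => ‖w k p - x p‖ₑ) ω) atTop (𝓝 0) := by
  have hdist : ∀ k, AEMeasurable (fun p => ‖w k p - x p‖ₑ ^ 2) (controlMeasure P τ T) :=
    fun k => ((hw k).sub hx).enorm.pow_const 2
  simp only [fun k => lintegral_controlMeasure hτ (hdist k)] at hsum
  filter_upwards [ae_tendsto_zero_of_tsum_lintegral_ne_top
    (fun k => aemeasurable_timeIntegral hτ (hdist k)) hsum,
    ae_all_iff.2 fun k => ae_aestronglyMeasurable_slice hτ ((hw k).sub hx)] with ω hlim hslice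
  have hbound : Tendsto (fun k => timeIntegral τ T (fun p => ‖w k p - x p‖ₑ ^ 2) ω *
      volume.restrict (Icc (τ ω : ℝ) T) univ) atTop (𝓝 0) := by
    have hfin := measure_ne_top (volume.restrict (Icc (τ ω : ℝ) T)) univ
    simpa only [zero_mul] using ENNReal.Tendsto.mul_const hlim (.inr hfin)
  exact tendsto_zero_of_tendsto_sq_zero <| tendsto_of_tendsto_of_tendsto_of_le_of_le
    tendsto_const_nhds hbound (fun _ => zero_le) fun k => lintegral_enorm_sq_le (hslice k)

end StochasticInterval

section AdmissibleControl

variable {Ω : Type*} {mΩ : MeasurableSpace Ω} {n : ℕ} {P : Measure Ω} {𝓕 : Filtration ℝ≥0 mΩ}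
  {T : ℝ≥0} {Γ K : Set (Vec n)} {τ : Ω → ℝ≥0} {Y : Ω → Vec n}

theorem IsAdmissible.uncurryReal_mem {u : ℝ≥0 → Ω → Vec n} (hu : IsAdmissible P 𝓕 T Γ K τ Y u)
    {p : Ω × ℝ} (hp : p ∈ stochasticInterval τ T) : uncurryReal u p ∈ K :=
  hu.mem _ _ (toNNReal_mem_Icc hp).1 (toNNReal_mem_Icc hp).2

theorem IsAdmissible.aestronglyMeasurable (hτ : Measurable τ) {u : ℝ≥0 → Ω → Vec n}
    (hu : IsAdmissible P 𝓕 T Γ K τ Y u) :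
    AEStronglyMeasurable (uncurryReal u) (controlMeasure P τ T) :=
  ⟨_, (hu.measurable.comp
    (measurable_snd.real_toNNReal.prodMk measurable_fst)).stronglyMeasurable,
    ae_controlMeasure_of_forall hτ fun _ hp => (if_pos (toNNReal_mem_Icc hp)).symm⟩

theorem IsAdmissible.zero (h₀ : 0 ∈ K) (hY : ∀ᵐ ω ∂P, Y ω ∈ Γ) :
    IsAdmissible P 𝓕 T Γ K τ Y 0 where
  mem _ _ _ _ := h₀
  measurable := by
    simpa only [Pi.zero_apply, indicator_zero] using measurable_const
  adapted s _ := by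
    simpa only [Pi.zero_apply, indicator_zero'] using @measurable_zero _ _ _ (𝓕 s) _
  integrableOn := .of_forall fun _ => integrableOn_zero
  constraint := by
    simpa only [Pi.zero_apply, integral_zero, add_zero] using hY

theorem convex_setOf_isAdmissible (hΓ : Convex ℝ Γ) (hK : Convex ℝ K) :
    Convex ℝ {u | IsAdmissible P 𝓕 T Γ K τ Y u} := by
  intro u hu v hv a b ha hb hab
  refine ⟨fun ω s h h' => hK (hu.mem ω s h h') (hv.mem ω s h h') ha hb hab, ?_, fun s hs => ?_,
    ?_, ?_⟩
  · convert (hu.measurable.const_smul a).add (hv.measurable.const_smul b) using 1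
    ext1 p
    by_cases hp : τ p.2 ≤ p.1 ∧ p.1 ≤ T <;> simp [indicator, hp]
  · convert ((hu.adapted s hs).const_smul a).add ((hv.adapted s hs).const_smul b) using 1
    ext1 ω
    by_cases hω : τ ω ≤ s <;> simp [indicator, hω]
  · filter_upwards [hu.integrableOn, hv.integrableOn] with ω hu_int hv_int
    exact (hu_int.smul a).add (hv_int.smul b)
  · filter_upwards [hu.integrableOn, hv.integrableOn, hu.constraint, hv.constraint]
      with ω hu_int hv_int hu_mem hv_mem
    convert hΓ hu_mem hv_mem ha hb hab using 1
    simp only [Pi.add_apply, Pi.smul_apply]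
    rw [integral_add (hu_int.fun_smul a) (hv_int.fun_smul b), integral_smul, integral_smul,
      smul_add, smul_add, add_add_add_comm, ← add_smul, hab, one_smul]

open Classical in
theorem IsAdmissible.ite (hτ : IsStoppingTime 𝓕 fun ω => (τ ω : WithTop ℝ≥0))
    {u v : ℝ≥0 → Ω → Vec n} (hu : IsAdmissible P 𝓕 T Γ K τ Y u)
    (hv : IsAdmissible P 𝓕 T Γ K τ Y v) {A : Set Ω} (hA : MeasurableSet[hτ.measurableSpace] A) :
    IsAdmissible P 𝓕 T Γ K τ Y fun s ω => if ω ∈ A then u s ω else v s ω where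
  mem ω s h h' := by
    split_ifs
    exacts [hu.mem ω s h h', hv.mem ω s h h']
  measurable := by
    have hA' : MeasurableSet {p : ℝ≥0 × Ω | p.2 ∈ A} :=
      measurable_snd (hτ.measurableSpace_le A hA)
    convert (hu.measurable.indicator hA').add (hv.measurable.indicator hA'.compl) using 1
    ext1 p
    by_cases hp : p.2 ∈ A <;> simp [indicator, hp]
  adapted s hs := by
    have hinter : ∀ B, MeasurableSet[hτ.measurableSpace] B →
        MeasurableSet[𝓕 s] (B ∩ {ω | τ ω ≤ s}) := fun B hB => by
      simpa only [WithTop.coe_le_coe] using ((hτ.measurableSet B).1 hB).2 s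
    convert ((hu.adapted s hs).indicator (hinter A hA)).add
      ((hv.adapted s hs).indicator (hinter _ hA.compl)) using 1
    ext1 ω
    by_cases hω : ω ∈ A <;> by_cases h : τ ω ≤ s <;> simp [indicator, hω, h]
  integrableOn := by
    filter_upwards [hu.integrableOn, hv.integrableOn] with ω hu_int hv_int
    by_cases hω : ω ∈ A <;> simpa [hω]
  constraint := by
    filter_upwards [hu.constraint, hv.constraint] with ω hu_mem hv_mem
    by_cases hω : ω ∈ A <;> simpa [hω]

open Classical in
theorem condLExp_le_condLExp_of_forall_lintegral_le [IsFiniteMeasure P]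
    (hτ : IsStoppingTime 𝓕 fun ω => (τ ω : WithTop ℝ≥0)) {L : (ℝ≥0 → Ω → Vec n) → Ω → ℝ≥0∞}
    (hL : ∀ u v ω, (∀ s, u s ω = v s ω) → L u ω = L v ω) {u v : ℝ≥0 → Ω → Vec n}
    (hu : IsAdmissible P 𝓕 T Γ K τ Y u) (hfin : ∫⁻ ω, L u ω ∂P ≠ ∞)
    (hmin : ∀ w, IsAdmissible P 𝓕 T Γ K τ Y w → ∫⁻ ω, L u ω ∂P ≤ ∫⁻ ω, L w ω ∂P)
    (hv : IsAdmissible P 𝓕 T Γ K τ Y v) :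
    condLExp hτ.measurableSpace P (L u) ≤ᵐ[P] condLExp hτ.measurableSpace P (L v) := by
  refine condLExp_le_condLExp_of_forall_setLIntegral_le hτ.measurableSpace_le fun A hA => ?_
  have hA' := hτ.measurableSpace_le A hA
  set w : ℝ≥0 → Ω → Vec n := fun s ω => if ω ∈ A then v s ω else u s ω
  have hwA : ∫⁻ ω in A, L w ω ∂P = ∫⁻ ω in A, L v ω ∂P :=
    setLIntegral_congr_fun hA' fun ω hω => hL w v ω fun _ => if_pos hω
  have hwAc : ∫⁻ ω in Aᶜ, L w ω ∂P = ∫⁻ ω in Aᶜ, L u ω ∂P :=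
    setLIntegral_congr_fun hA'.compl fun ω hω => hL w u ω fun _ => if_neg hω
  have hle : ∫⁻ ω in A, L u ω ∂P + ∫⁻ ω in Aᶜ, L u ω ∂P ≤
      ∫⁻ ω in A, L v ω ∂P + ∫⁻ ω in Aᶜ, L u ω ∂P :=
    calc _ = ∫⁻ ω, L u ω ∂P := lintegral_add_compl _ hA'
      _ ≤ ∫⁻ ω, L w ω ∂P := hmin w (hv.ite hτ hu hA)
      _ = _ := by rw [← lintegral_add_compl _ hA', hwA, hwAc]
  exact (ENNReal.add_le_add_iff_right
    (ne_top_of_le_ne_top hfin (setLIntegral_le_lintegral _ _))).1 hle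

variable {w : ℕ → ℝ≥0 → Ω → Vec n} (hw : ∀ k, IsAdmissible P 𝓕 T Γ K τ Y (w k))
include hw

theorem uncurryReal_limOrZero_ae_eq (hτ : Measurable τ) {x : Ω × ℝ → Vec n}
    (hx : AEStronglyMeasurable x (controlMeasure P τ T))
    (hsum : ∑' k, ∫⁻ p, ‖uncurryReal (w k) p - x p‖ₑ ^ 2 ∂controlMeasure P τ T ≠ ∞) :
    uncurryReal (fun s ω => limOrZero fun k => w k s ω) =ᵐ[controlMeasure P τ T] x := by
  filter_upwards [ae_tendsto_of_tsum_lintegral_enorm_sub_sq_ne_top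
    (fun k => (hw k).aestronglyMeasurable hτ) hx hsum] with p hp
  exact limOrZero_eq hp

theorem isAdmissible_limOrZero (hτ : Measurable τ) (hΓ : IsClosed Γ) (hK : IsClosed K)
    (h₀ : 0 ∈ K) {x : Ω × ℝ → Vec n} (hx : AEStronglyMeasurable x (controlMeasure P τ T))
    (hsum : ∑' k, ∫⁻ p, ‖uncurryReal (w k) p - x p‖ₑ ^ 2 ∂controlMeasure P τ T ≠ ∞) :
    IsAdmissible P 𝓕 T Γ K τ Y fun s ω => limOrZero fun k => w k s ω := by
  set u : ℝ≥0 → Ω → Vec n := fun s ω => limOrZero fun k => w k s ω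
  have hux : uncurryReal u =ᵐ[controlMeasure P τ T] x :=
    uncurryReal_limOrZero_ae_eq hw hτ hx hsum
  have hpath : ∀ᵐ ω ∂P, IntegrableOn (fun s : ℝ => u s.toNNReal ω) (Icc (τ ω : ℝ) T) ∧
      Tendsto (fun k => ∫ s in Icc (τ ω : ℝ) T, w k s.toNNReal ω) atTop
        (𝓝 (∫ s in Icc (τ ω : ℝ) T, u s.toNNReal ω)) := by
    have hwm := fun k => (hw k).aestronglyMeasurable hτ
    filter_upwards [ae_tendsto_timeIntegral_enorm_sub hτ hwm hx hsum,
      ae_ae_of_ae_controlMeasure hτ hux, ae_aestronglyMeasurable_slice hτ (hx.congr hux.symm),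
      ae_all_iff.2 fun k => (hw k).integrableOn] with ω hL1 hslice hmeas hw_int
    replace hL1 : Tendsto (fun k => ∫⁻ s in Icc (τ ω : ℝ) T, ‖w k s.toNNReal ω - u s.toNNReal ω‖ₑ)
        atTop (𝓝 0) := hL1.congr fun k => lintegral_congr_ae <| by
      filter_upwards [hslice] with s hs
      rw [← hs]
      rfl
    have hu_int := integrable_of_tendsto_lintegral_enorm_sub hw_int hmeas hL1
    exact ⟨hu_int, tendsto_integral_of_L1 _ hu_int.1 (.of_forall hw_int) hL1⟩
  refine ⟨fun ω s h h' => limOrZero_mem hK h₀ fun k => (hw k).mem ω s h h', ?_, fun s hs => ?_,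
    hpath.mono fun _ hω => hω.1, ?_⟩
  · rw [indicator_limOrZero]
    exact measurable_limOrZero fun k => (hw k).measurable
  · rw [indicator_limOrZero]
    exact measurable_limOrZero fun k => (hw k).adapted s hs
  · filter_upwards [hpath, ae_all_iff.2 fun k => (hw k).constraint] with ω hω hmem
    exact hΓ.mem_of_tendsto (tendsto_const_nhds.add hω.2) (.of_forall hmem)

end AdmissibleControl

/-- A running payoff `f(x, u, s)` for controls with values in a closed set `K`, concave in `u` and
normalized by `f(x, 0, s) = 0`, for which `f(x, u, s) + c ‖u‖²` is at most `C (1 + ‖x‖²)`. These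
are the payoffs for which minimizing controls are bounded in `L²`. -/
structure IsCoercivePayoff {n : ℕ} (K : Set (Vec n)) (f : Vec n → Vec n → ℝ≥0 → ℝ) (c C : ℝ) :
    Prop where
  isClosed : IsClosed K
  zero_mem : 0 ∈ K
  measurable : Measurable fun p : Vec n × Vec n × ℝ≥0 => f p.1 p.2.1 p.2.2
  continuous : ∀ x s, Continuous fun u => f x u s
  concaveOn : ∀ x s, ConcaveOn ℝ K fun u => f x u s
  zero : ∀ x s, f x 0 s = 0
  pos : 0 < c
  coercive : ∀ x s, ∀ u ∈ K, c * ‖u‖ ^ 2 + f x u s ≤ C * (1 + ‖x‖ ^ 2)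

/-- The bound `C (1 + ‖x‖²)` for the running payoff along the process `x`. -/
noncomputable def payoffBound {α : Type*} {n : ℕ} (C : ℝ) (x : α → Vec n) (p : α) : ℝ≥0∞ :=
  ENNReal.ofReal (C * (1 + ‖x p‖ ^ 2))

/-- The amount `C (1 + ‖x‖²) - f(x, v, s)` by which the running payoff of the control `v` along the
process `x` misses its bound. Maximizing the payoff means minimizing this `[0, ∞]`-valued loss. -/
noncomputable def loss {Ω : Type*} {n : ℕ} (f : Vec n → Vec n → ℝ≥0 → ℝ) (C : ℝ)
    (x v : Ω × ℝ → Vec n) (p : Ω × ℝ) : ℝ≥0∞ :=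
  ENNReal.ofReal (C * (1 + ‖x p‖ ^ 2) - f (x p) (v p) p.2.toNNReal)

section CoercivePayoff

variable {Ω : Type*} {mΩ : MeasurableSpace Ω} {n : ℕ} {K : Set (Vec n)}
  {f : Vec n → Vec n → ℝ≥0 → ℝ} {c C : ℝ} {μ : Measure (Ω × ℝ)} {x v : Ω × ℝ → Vec n}

theorem aemeasurable_payoffBound {α : Type*} [MeasurableSpace α] {μ : Measure α}
    {x : α → Vec n} (hx : AEStronglyMeasurable x μ) : AEMeasurable (payoffBound C x) μ :=
  (((hx.norm.aemeasurable.pow_const 2).const_add 1).const_mul C).ennreal_ofReal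

theorem lintegral_payoffBound_ne_top {α : Type*} [MeasurableSpace α] {μ : Measure α}
    [IsFiniteMeasure μ] {x : α → Vec n} (hx : MemLp x 2 μ) :
    ∫⁻ p, payoffBound C x p ∂μ ≠ ∞ :=
  (((integrable_const 1).add hx.integrable_norm_pow').const_mul C).lintegral_lt_top.ne

namespace IsCoercivePayoff

theorem aemeasurable_loss (hf : IsCoercivePayoff K f c C) (hx : AEStronglyMeasurable x μ)
    (hv : AEStronglyMeasurable v μ) : AEMeasurable (loss f C x v) μ :=
  ((((hx.norm.aemeasurable.pow_const 2).const_add 1).const_mul C).sub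
    (hf.measurable.comp_aemeasurable (hx.aemeasurable.prodMk
      (hv.aemeasurable.prodMk measurable_snd.real_toNNReal.aemeasurable)))).ennreal_ofReal

theorem bound_nonneg (hf : IsCoercivePayoff K f c C) (y : Vec n) : 0 ≤ C * (1 + ‖y‖ ^ 2) := by
  simpa [hf.zero] using hf.coercive y 0 0 hf.zero_mem

theorem coe_eq_payoffBound_sub_loss (hf : IsCoercivePayoff K f c C) {p : Ω × ℝ} (hp : v p ∈ K) :
    (f (x p) (v p) p.2.toNNReal : EReal) = payoffBound C x p - loss f C x v p := by
  have hcoer := hf.coercive (x p) p.2.toNNReal (v p) hp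
  have hc := mul_nonneg hf.pos.le (sq_nonneg ‖v p‖)
  rw [payoffBound, loss, EReal.coe_ennreal_ofReal, EReal.coe_ennreal_ofReal,
    max_eq_left (hf.bound_nonneg _), max_eq_left (by linarith), ← EReal.coe_sub, sub_sub_cancel]

theorem enorm_sq_le_loss (hf : IsCoercivePayoff K f c C) {p : Ω × ℝ} (hp : v p ∈ K) :
    ‖v p‖ₑ ^ 2 ≤ ENNReal.ofReal c⁻¹ * loss f C x v p := by
  rw [loss, ← ENNReal.ofReal_mul (inv_nonneg.2 hf.pos.le), ← ofReal_norm,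
    ← ENNReal.ofReal_pow (norm_nonneg _)]
  refine ENNReal.ofReal_le_ofReal ((le_inv_mul_iff₀ hf.pos).2 ?_)
  linarith [hf.coercive (x p) p.2.toNNReal (v p) hp]

theorem loss_add_smul_le (hf : IsCoercivePayoff K f c C) {w : Ω × ℝ → Vec n} {p : Ω × ℝ}
    (hv : v p ∈ K) (hw : w p ∈ K) {a b : ℝ} (ha : 0 ≤ a) (hb : 0 ≤ b) (hab : a + b = 1) :
    loss f C x (a • v + b • w) p ≤
      ENNReal.ofReal a * loss f C x v p + ENNReal.ofReal b * loss f C x w p := by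
  have hconc := (hf.concaveOn (x p) p.2.toNNReal).2 hv hw ha hb hab
  rw [loss, loss, loss, ← ENNReal.ofReal_mul ha, ← ENNReal.ofReal_mul hb]
  refine (ENNReal.ofReal_le_ofReal ?_).trans ENNReal.ofReal_add_le
  rw [smul_eq_mul, smul_eq_mul] at hconc
  rw [Pi.add_apply, Pi.smul_apply, Pi.smul_apply]
  linear_combination hconc - C * (1 + ‖x p‖ ^ 2) * hab

theorem quasiconvexOn_lintegral_loss (hf : IsCoercivePayoff K f c C)
    (hx : AEStronglyMeasurable x μ) {V : Set (Ω × ℝ → Vec n)} (hV : Convex ℝ V)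
    (hVm : ∀ v ∈ V, AEStronglyMeasurable v μ) (hVK : ∀ v ∈ V, ∀ᵐ p ∂μ, v p ∈ K) :
    QuasiconvexOn ℝ V fun v => ∫⁻ p, loss f C x v p ∂μ := by
  rintro r v ⟨hv, hvr⟩ w ⟨hw, hwr⟩ a b ha hb hab
  refine ⟨hV hv hw ha hb hab, ?_⟩
  calc ∫⁻ p, loss f C x (a • v + b • w) p ∂μ
      ≤ ∫⁻ p, (ENNReal.ofReal a * loss f C x v p + ENNReal.ofReal b * loss f C x w p) ∂μ := by
        refine lintegral_mono_ae ?_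
        filter_upwards [hVK v hv, hVK w hw] with p hvp hwp
        exact hf.loss_add_smul_le hvp hwp ha hb hab
    _ = ENNReal.ofReal a * ∫⁻ p, loss f C x v p ∂μ +
          ENNReal.ofReal b * ∫⁻ p, loss f C x w p ∂μ := by
        rw [lintegral_add_left' ((hf.aemeasurable_loss hx (hVm v hv)).const_mul _),
          lintegral_const_mul' _ _ ENNReal.ofReal_ne_top,
          lintegral_const_mul' _ _ ENNReal.ofReal_ne_top]
    _ ≤ ENNReal.ofReal a * r + ENNReal.ofReal b * r := by gcongr
    _ = r := by rw [← add_mul, ← ENNReal.ofReal_add ha hb, hab, ENNReal.ofReal_one, one_mul]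

theorem loss_zero (hf : IsCoercivePayoff K f c C) : loss f C x 0 = payoffBound C x := by
  funext p
  rw [loss, payoffBound, Pi.zero_apply, hf.zero, sub_zero]

theorem tendsto_loss (hf : IsCoercivePayoff K f c C) {w : ℕ → Ω × ℝ → Vec n} {p : Ω × ℝ}
    (h : Tendsto (fun k => w k p) atTop (𝓝 (v p))) :
    Tendsto (fun k => loss f C x (w k) p) atTop (𝓝 (loss f C x v p)) :=
  ENNReal.tendsto_ofReal (tendsto_const_nhds.sub
    (((hf.continuous (x p) p.2.toNNReal).tendsto (v p)).comp h))

end IsCoercivePayoff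

end CoercivePayoff

section Existence

variable {Ω : Type*} {mΩ : MeasurableSpace Ω} {n : ℕ} {P : Measure Ω} {𝓕 : Filtration ℝ≥0 mΩ}
  {T : ℝ≥0} {Γ K : Set (Vec n)} {f : Vec n → Vec n → ℝ≥0 → ℝ} {c C : ℝ} {X : ℝ≥0 → Ω → Vec n}
  {τ : Ω → ℝ≥0} {Y : Ω → Vec n} {u : ℝ≥0 → Ω → Vec n}

/-- The loss of the control `u` accumulated over `[τ, T]`, as a random variable. -/
noncomputable def totalLoss (f : Vec n → Vec n → ℝ≥0 → ℝ) (C : ℝ) (X : ℝ≥0 → Ω → Vec n) (T : ℝ≥0)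
    (τ : Ω → ℝ≥0) (u : ℝ≥0 → Ω → Vec n) : Ω → ℝ≥0∞ :=
  timeIntegral τ T (loss f C (uncurryReal X) (uncurryReal u))

theorem totalLoss_congr {u v : ℝ≥0 → Ω → Vec n} {ω : Ω} (h : ∀ s, u s ω = v s ω) :
    totalLoss f C X T τ u ω = totalLoss f C X T τ v ω := by
  simp only [totalLoss, timeIntegral, loss, uncurryReal, h]

theorem aemeasurable_timeIntegral_payoffBound (hτ : Measurable τ)
    (hX : AEStronglyMeasurable (uncurryReal X) (controlMeasure P τ T)) :
    AEMeasurable (timeIntegral τ T (payoffBound C (uncurryReal X))) P :=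
  aemeasurable_timeIntegral hτ (aemeasurable_payoffBound hX)

theorem lintegral_timeIntegral_payoffBound_ne_top [IsFiniteMeasure P] (hτ : Measurable τ)
    (hX : MemLp (uncurryReal X) 2 (controlMeasure P τ T)) :
    ∫⁻ ω, timeIntegral τ T (payoffBound C (uncurryReal X)) ω ∂P ≠ ∞ := by
  rw [← lintegral_controlMeasure hτ (aemeasurable_payoffBound hX.1)]
  exact lintegral_payoffBound_ne_top hX

namespace IsCoercivePayoff

variable (hf : IsCoercivePayoff K f c C) (hτ : Measurable τ)
include hf hτ

theorem aemeasurable_totalLoss (hX : AEStronglyMeasurable (uncurryReal X) (controlMeasure P τ T))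
    (hu : IsAdmissible P 𝓕 T Γ K τ Y u) : AEMeasurable (totalLoss f C X T τ u) P :=
  aemeasurable_timeIntegral hτ (hf.aemeasurable_loss hX (hu.aestronglyMeasurable hτ))

theorem lintegral_loss_limOrZero_le
    (hX : AEStronglyMeasurable (uncurryReal X) (controlMeasure P τ T))
    {w : ℕ → ℝ≥0 → Ω → Vec n} (hw : ∀ k, IsAdmissible P 𝓕 T Γ K τ Y (w k)) {x : Ω × ℝ → Vec n}
    (hx : AEStronglyMeasurable x (controlMeasure P τ T))
    (hsum : ∑' k, ∫⁻ p, ‖uncurryReal (w k) p - x p‖ₑ ^ 2 ∂controlMeasure P τ T ≠ ∞) {m : ℝ≥0∞}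
    (hm : Tendsto (fun k => ∫⁻ p, loss f C (uncurryReal X) (uncurryReal (w k)) p
      ∂controlMeasure P τ T) atTop (𝓝 m)) :
    ∫⁻ p, loss f C (uncurryReal X) (uncurryReal fun s ω => limOrZero fun k => w k s ω) p
      ∂controlMeasure P τ T ≤ m := by
  refine lintegral_le_of_ae_tendsto
    (fun k => hf.aemeasurable_loss hX ((hw k).aestronglyMeasurable hτ)) ?_ hm
  filter_upwards [ae_tendsto_of_tsum_lintegral_enorm_sub_sq_ne_top
      (fun k => (hw k).aestronglyMeasurable hτ) hx hsum,
    uncurryReal_limOrZero_ae_eq hw hτ hx hsum] with p hp heq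
  exact hf.tendsto_loss (heq ▸ hp)

variable [IsFiniteMeasure P] (hX : MemLp (uncurryReal X) 2 (controlMeasure P τ T))
include hX

theorem exists_isAdmissible_forall_lintegral_loss_le (hΓ : IsClosed Γ) (hΓc : Convex ℝ Γ)
    (hY : ∀ᵐ ω ∂P, Y ω ∈ Γ) :
    ∃ u, IsAdmissible P 𝓕 T Γ K τ Y u ∧ ∀ v, IsAdmissible P 𝓕 T Γ K τ Y v →
      ∫⁻ p, loss f C (uncurryReal X) (uncurryReal u) p ∂controlMeasure P τ T ≤
        ∫⁻ p, loss f C (uncurryReal X) (uncurryReal v) p ∂controlMeasure P τ T := by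
  set U : Set (Ω × ℝ → Vec n) := uncurryReal '' {u | IsAdmissible P 𝓕 T Γ K τ Y u}
  have hUc : Convex ℝ U := (convex_setOf_isAdmissible hΓc (hf.concaveOn 0 0).1).is_linear_image
    ⟨fun _ _ => rfl, fun _ _ => rfl⟩
  have hUm : ∀ v ∈ U, AEStronglyMeasurable v (controlMeasure P τ T) :=
    forall_mem_image.2 fun u hu => hu.aestronglyMeasurable hτ
  have hUK : ∀ v ∈ U, ∀ᵐ p ∂controlMeasure P τ T, v p ∈ K :=
    forall_mem_image.2 fun u hu => ae_controlMeasure_of_forall hτ fun _ hp => hu.uncurryReal_mem hp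
  have hcoer : ∀ v ∈ U, ∫⁻ p, ‖v p‖ₑ ^ 2 ∂controlMeasure P τ T ≤
      ENNReal.ofReal c⁻¹ * ∫⁻ p, loss f C (uncurryReal X) v p ∂controlMeasure P τ T := by
    intro v hv
    rw [← lintegral_const_mul' _ _ ENNReal.ofReal_ne_top]
    exact lintegral_mono_ae ((hUK v hv).mono fun _ hp => hf.enorm_sq_le_loss hp)
  have hzero : ∫⁻ p, loss f C (uncurryReal X) 0 p ∂controlMeasure P τ T ≠ ∞ := by
    rw [hf.loss_zero]
    exact lintegral_payoffBound_ne_top hX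
  obtain ⟨v, x, hv, hlim, hx, hsum⟩ := exists_minimizing_seq_of_quasiconvexOn
    (hf.quasiconvexOn_lintegral_loss hX.1 hUc hUm hUK) hUm ENNReal.ofReal_ne_top hcoer
    ⟨0, ⟨0, .zero hf.zero_mem hY, rfl⟩, hzero⟩
  choose w hw hwv using hv
  obtain rfl : (fun k => uncurryReal (w k)) = v := funext hwv
  exact ⟨_, isAdmissible_limOrZero hw hτ hΓ hf.isClosed hf.zero_mem hx hsum, fun u hu =>
    (hf.lintegral_loss_limOrZero_le hτ hX.1 hw hx hsum hlim).trans
      (iInf₂_le _ (mem_image_of_mem _ hu))⟩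

theorem exists_isAdmissible_forall_lintegral_totalLoss_le (hΓ : IsClosed Γ) (hΓc : Convex ℝ Γ)
    (hY : ∀ᵐ ω ∂P, Y ω ∈ Γ) :
    ∃ u, IsAdmissible P 𝓕 T Γ K τ Y u ∧ ∫⁻ ω, totalLoss f C X T τ u ω ∂P ≠ ∞ ∧
      ∀ v, IsAdmissible P 𝓕 T Γ K τ Y v →
        ∫⁻ ω, totalLoss f C X T τ u ω ∂P ≤ ∫⁻ ω, totalLoss f C X T τ v ω ∂P := by
  obtain ⟨u, hu, hmin⟩ :=
    hf.exists_isAdmissible_forall_lintegral_loss_le (𝓕 := 𝓕) hτ hX hΓ hΓc hY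
  have htotal : ∀ v, IsAdmissible P 𝓕 T Γ K τ Y v → ∫⁻ ω, totalLoss f C X T τ v ω ∂P =
      ∫⁻ p, loss f C (uncurryReal X) (uncurryReal v) p ∂controlMeasure P τ T := fun v hv =>
    (lintegral_controlMeasure hτ (hf.aemeasurable_loss hX.1 (hv.aestronglyMeasurable hτ))).symm
  refine ⟨u, hu, ?_, fun v hv => ?_⟩
  · rw [htotal u hu]
    refine ne_top_of_le_ne_top (lintegral_payoffBound_ne_top (C := C) hX) ?_
    rw [← hf.loss_zero]
    exact hmin 0 (.zero hf.zero_mem hY)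
  · rw [htotal u hu, htotal v hv]
    exact hmin v hv

variable (hu : IsAdmissible P 𝓕 T Γ K τ Y u)
include hu

theorem payoff_ae_eq : payoff f X T τ u =ᵐ[P] fun ω =>
    (timeIntegral τ T (payoffBound C (uncurryReal X)) ω : EReal) - totalLoss f C X T τ u ω := by
  have hloss := hf.aemeasurable_loss hX.1 (hu.aestronglyMeasurable hτ)
  filter_upwards [
    ae_aestronglyMeasurable_slice hτ (aemeasurable_payoffBound (C := C) hX.1).aestronglyMeasurable,
    ae_aestronglyMeasurable_slice hτ hloss.aestronglyMeasurable,
    ae_lt_top' (aemeasurable_timeIntegral_payoffBound (C := C) hτ hX.1)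
      (lintegral_timeIntegral_payoffBound_ne_top hτ hX)] with ω hbound_slice hloss_slice hfin
  refine (extIntegral_congr_ae ?_).trans
    (extIntegral_coe_sub_coe hbound_slice.aemeasurable hloss_slice.aemeasurable hfin.ne)
  filter_upwards [ae_restrict_mem measurableSet_Icc] with s hs
  exact hf.coe_eq_payoffBound_sub_loss (x := uncurryReal X) (p := (ω, s)) (hu.uncurryReal_mem hs)

theorem extIntegral_payoff : extIntegral P (payoff f X T τ u) =
    (∫⁻ ω, timeIntegral τ T (payoffBound C (uncurryReal X)) ω ∂P : ℝ≥0∞) -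
      (∫⁻ ω, totalLoss f C X T τ u ω ∂P : ℝ≥0∞) :=
  (extIntegral_congr_ae (hf.payoff_ae_eq hτ hX hu)).trans <|
    extIntegral_coe_sub_coe (aemeasurable_timeIntegral_payoffBound hτ hX.1)
      (hf.aemeasurable_totalLoss hτ hX.1 hu) (lintegral_timeIntegral_payoffBound_ne_top hτ hX)

theorem extCondExp_payoff_ae_eq (m : MeasurableSpace Ω) :
    extCondExp m P (payoff f X T τ u) =ᵐ[P] fun ω =>
      (condLExp m P (timeIntegral τ T (payoffBound C (uncurryReal X))) ω : EReal) -
        condLExp m P (totalLoss f C X T τ u) ω :=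
  (extCondExp_congr_ae m (hf.payoff_ae_eq hτ hX hu)).trans <|
    extCondExp_coe_sub_coe m (aemeasurable_timeIntegral_payoffBound hτ hX.1)
      (hf.aemeasurable_totalLoss hτ hX.1 hu) (lintegral_timeIntegral_payoffBound_ne_top hτ hX)

end IsCoercivePayoff

end Existence

section ModelAssumptions

variable {n : ℕ}

theorem constraintSet_eq_image (Γ₀ : Set (Vec n)) (g : Vec n) :
    constraintSet Γ₀ g = (fun x => g + x) '' Γ₀ :=
  Set.ext fun y => exists_congr fun x => and_congr_right fun _ => by rw [add_comm, eq_comm]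

theorem isClosed_constraintSet {Γ₀ : Set (Vec n)} (h : IsClosed Γ₀) (g : Vec n) :
    IsClosed (constraintSet Γ₀ g) := by
  rw [constraintSet_eq_image]
  exact (Homeomorph.addLeft g).isClosedMap _ h

theorem convex_constraintSet {Γ₀ : Set (Vec n)} (h : Convex ℝ Γ₀) (g : Vec n) :
    Convex ℝ (constraintSet Γ₀ g) := by
  rw [constraintSet_eq_image]
  exact h.translate g

theorem dotProduct_ofLp_eq_inner (x u : Vec n) : u.ofLp ⬝ᵥ x.ofLp = inner ℝ x u := by
  rw [EuclideanSpace.inner_eq_star_dotProduct, star_trivial]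

theorem isCoercivePayoff_dotProduct {L : ℝ} (hL : 0 < L) :
    IsCoercivePayoff {v : Vec n | ∀ i, 0 ≤ v i ∧ v i ≤ L} (fun x u _ => u.ofLp ⬝ᵥ x.ofLp) 1
      (3 / 2 * (n * L ^ 2) + 1 / 2) := by
  have hK : {v : Vec n | ∀ i, 0 ≤ v i ∧ v i ≤ L} =
      ⋂ i, (EuclideanSpace.proj i : Vec n →L[ℝ] ℝ) ⁻¹' Icc 0 L := by
    ext v
    simp
  simp only [dotProduct_ofLp_eq_inner, hK]
  refine ⟨isClosed_iInter fun i => isClosed_Icc.preimage (by fun_prop), by simp [hL.le],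
    by fun_prop, fun x _ => by fun_prop, fun x _ => ?_, fun x _ => inner_zero_right x, one_pos,
    fun x _ u hu => ?_⟩
  · exact (innerₗ (Vec n) x).concaveOn
      (convex_iInter fun i => (convex_Icc 0 L).linear_preimage (EuclideanSpace.proj i).toLinearMap)
  · have hu_sq : ‖u‖ ^ 2 ≤ n * L ^ 2 := by
      rw [EuclideanSpace.real_norm_sq_eq]
      calc ∑ i, u i ^ 2 ≤ ∑ _i : Fin n, L ^ 2 := Finset.sum_le_sum fun i _ =>
            pow_le_pow_left₀ (mem_iInter.1 hu i).1 (mem_iInter.1 hu i).2 2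
        _ = n * L ^ 2 := by simp
    have hamgm : inner ℝ x u ≤ ‖x‖ ^ 2 / 2 + ‖u‖ ^ 2 / 2 := by
      linarith [real_inner_le_norm x u, two_mul_le_add_sq ‖x‖ ‖u‖]
    have hprod : 0 ≤ n * L ^ 2 * ‖x‖ ^ 2 := by positivity
    linarith

theorem exists_mul_norm_sq_le {E : Type*} [NormedAddCommGroup E] [NormedSpace ℝ E] [ProperSpace E]
    {q : E → ℝ} (hq : Continuous q) (hsmul : ∀ (a : ℝ) u, q (a • u) = a ^ 2 * q u)
    (hpos : ∀ u ≠ 0, 0 < q u) : ∃ c : ℝ, 0 < c ∧ ∀ u, c * ‖u‖ ^ 2 ≤ q u := by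
  obtain ⟨c, hc, hmin⟩ := (isCompact_sphere (0 : E) 1).exists_forall_le' hq.continuousOn
    fun u hu => hpos u (ne_zero_of_mem_sphere one_ne_zero ⟨u, hu⟩)
  refine ⟨c, hc, fun u => ?_⟩
  rcases eq_or_ne u 0 with rfl | hu
  · simpa using (hsmul 0 0).ge
  · have hmem : ‖u‖⁻¹ • u ∈ Metric.sphere (0 : E) 1 :=
      mem_sphere_zero_iff_norm.2 (norm_smul_inv_norm (𝕜 := ℝ) hu)
    calc c * ‖u‖ ^ 2 ≤ q (‖u‖⁻¹ • u) * ‖u‖ ^ 2 := by gcongr; exact hmin _ hmem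
      _ = q u := by
        have hu_norm := norm_ne_zero_iff.2 hu
        rw [hsmul]
        field_simp

theorem continuous_dotProduct_mulVec (G : Matrix (Fin n) (Fin n) ℝ) :
    Continuous fun u : Vec n => u.ofLp ⬝ᵥ (G *ᵥ u.ofLp) := by
  simp only [dotProduct, mulVec]
  fun_prop

theorem exists_mul_norm_sq_le_dotProduct_mulVec {G : Matrix (Fin n) (Fin n) ℝ} (hG : G.PosDef) :
    ∃ c : ℝ, 0 < c ∧ ∀ u : Vec n, c * ‖u‖ ^ 2 ≤ u.ofLp ⬝ᵥ (G *ᵥ u.ofLp) :=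
  exists_mul_norm_sq_le (continuous_dotProduct_mulVec G)
    (fun a u => by
      rw [WithLp.ofLp_smul, mulVec_smul, smul_dotProduct, dotProduct_smul, smul_eq_mul,
        smul_eq_mul, ← mul_assoc, sq])
    fun u hu => by simpa using hG.dotProduct_mulVec_pos ((WithLp.ofLp_eq_zero 2).not.2 hu)

theorem convexOn_dotProduct_mulVec {G : Matrix (Fin n) (Fin n) ℝ} (hG : G.PosSemidef) :
    ConvexOn ℝ univ fun u : Vec n => u.ofLp ⬝ᵥ (G *ᵥ u.ofLp) := by
  refine ⟨convex_univ, fun u _ v _ a b ha hb hab => ?_⟩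
  have hdiff : 0 ≤ (u - v).ofLp ⬝ᵥ (G *ᵥ (u - v).ofLp) := by
    simpa using hG.dotProduct_mulVec_nonneg (u - v).ofLp
  have hgap := mul_nonneg (mul_nonneg ha hb) hdiff
  obtain rfl : b = 1 - a := by linarith
  simp only [WithLp.ofLp_sub, WithLp.ofLp_add, WithLp.ofLp_smul, mulVec_add, mulVec_sub,
    mulVec_smul, add_dotProduct, sub_dotProduct, dotProduct_add, dotProduct_sub,
    smul_dotProduct, dotProduct_smul, smul_eq_mul] at hgap ⊢
  linarith

theorem exists_isCoercivePayoff_sub_dotProduct_mulVec {G : Matrix (Fin n) (Fin n) ℝ}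
    (hG : G.PosDef) : ∃ c C, IsCoercivePayoff (univ : Set (Vec n))
      (fun x u _ => u.ofLp ⬝ᵥ x.ofLp - u.ofLp ⬝ᵥ (G *ᵥ u.ofLp)) c C := by
  obtain ⟨c, hc, hle⟩ := exists_mul_norm_sq_le_dotProduct_mulVec hG
  have hcont := continuous_dotProduct_mulVec G
  simp only [dotProduct_ofLp_eq_inner]
  refine ⟨c / 2, 1 / (2 * c), isClosed_univ, mem_univ 0,
    (measurable_fst.inner measurable_snd.fst).sub (hcont.measurable.comp measurable_snd.fst),
    fun x _ => (by fun_prop : Continuous fun u => inner ℝ x u).sub hcont,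
    fun x _ => ((innerₗ (Vec n) x).concaveOn convex_univ).sub
      (convexOn_dotProduct_mulVec hG.posSemidef), fun x _ => by simp, half_pos hc,
    fun x _ u _ => ?_⟩
  have hamgm : ‖x‖ * ‖u‖ ≤ c / 2 * ‖u‖ ^ 2 + 1 / (2 * c) * ‖x‖ ^ 2 := by
    have hsq : 0 ≤ (c * ‖u‖ - ‖x‖) ^ 2 / (2 * c) := by positivity
    have hexpand : (c * ‖u‖ - ‖x‖) ^ 2 / (2 * c) =
        c / 2 * ‖u‖ ^ 2 + 1 / (2 * c) * ‖x‖ ^ 2 - ‖x‖ * ‖u‖ := by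
      field_simp
      ring
    linarith
  have hconst : 0 < 1 / (2 * c) := by positivity
  linarith [hle u, real_inner_le_norm x u]

theorem exists_isCoercivePayoff {K : Set (Vec n)} {f : Vec n → Vec n → ℝ≥0 → ℝ}
    (h : IsLinearCase K f ∨ IsQuadraticCase K f) : ∃ c C, IsCoercivePayoff K f c C := by
  rcases h with ⟨L, hL, rfl, hf⟩ | ⟨G, hG, rfl, hf⟩
  · obtain rfl : f = fun x u _ => u.ofLp ⬝ᵥ x.ofLp := by
      funext x u s
      exact hf x u s
    exact ⟨_, _, isCoercivePayoff_dotProduct hL⟩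
  · obtain rfl : f = fun x u _ => u.ofLp ⬝ᵥ x.ofLp - u.ofLp ⬝ᵥ (G *ᵥ u.ofLp) := by
      funext x u s
      exact hf x u s
    exact exists_isCoercivePayoff_sub_dotProduct_mulVec hG

variable {Ω : Type*} {mΩ : MeasurableSpace Ω} {P : Measure Ω}

theorem measurable_of_isStoppingTime {𝓕 : Filtration ℝ≥0 mΩ} {τ : Ω → ℝ≥0}
    (hτ : IsStoppingTime 𝓕 fun ω => (τ ω : WithTop ℝ≥0)) : Measurable τ := by
  refine measurable_of_Iic fun s => ?_
  have hs : MeasurableSet {ω | τ ω ≤ s} := by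
    simpa only [WithTop.coe_le_coe] using 𝓕.le s _ (hτ s)
  exact hs

theorem aemeasurable_uncurryReal {E : Type*} [TopologicalSpace E]
    [TopologicalSpace.PseudoMetrizableSpace E] [MeasurableSpace E] [BorelSpace E]
    {X : ℝ≥0 → Ω → E} (hX : ∀ s, Measurable (X s))
    (hrc : ∀ᵐ ω ∂P, ∀ s, ContinuousWithinAt (fun r => X r ω) (Ici s) s) :
    AEMeasurable (uncurryReal X) (P.prod volume) := by
  -- `r k s` is the first point to the right of `s` on the grid of mesh `1 / (k + 1)`.
  set r : ℕ → ℝ≥0 → ℝ≥0 := fun k s => (⌊s * (k + 1)⌋₊ + 1) / (k + 1) with hr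
  have hr_ge : ∀ k s, s ≤ r k s := fun k s => by
    rw [hr, le_div_iff₀ (by positivity)]
    exact (Nat.lt_floor_add_one _).le
  have hr_le : ∀ k s, r k s ≤ s + 1 / (k + 1) := fun k s => by
    rw [hr, div_le_iff₀ (by positivity), add_mul, one_div, inv_mul_cancel₀ (by positivity)]
    gcongr
    exact Nat.floor_le zero_le
  have hr_lim : ∀ s, Tendsto (fun k => r k s) atTop (𝓝[≥] s) := fun s => by
    refine tendsto_nhdsWithin_iff.2 ⟨?_, .of_forall fun k => hr_ge k s⟩
    refine tendsto_of_tendsto_of_tendsto_of_le_of_le tendsto_const_nhds ?_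
      (fun k => hr_ge k s) (fun k => hr_le k s)
    simpa using (tendsto_const_nhds (x := s)).add
      (tendsto_one_div_add_atTop_nhds_zero_nat (𝕜 := ℝ≥0))
  refine aemeasurable_of_tendsto_metrizable_ae atTop
    (f := fun k p => X (r k p.2.toNNReal) p.1) (fun k => ?_) ?_
  · have hgrid : Measurable fun q : ℕ × Ω => X ((q.1 + 1) / (k + 1)) q.2 :=
      measurable_from_prod_countable_right fun m => hX ((m + 1) / (k + 1))
    have hfloor : Measurable fun p : Ω × ℝ => ⌊p.2.toNNReal * (k + 1)⌋₊ :=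
      Nat.measurable_floor.comp (by fun_prop)
    exact (hgrid.comp (hfloor.prodMk measurable_fst)).aemeasurable
  · filter_upwards [Measure.quasiMeasurePreserving_fst.ae hrc] with p hp
    exact (hp p.2.toNNReal).tendsto.comp (hr_lim p.2.toNNReal)

theorem memLp_uncurryReal {X : ℝ≥0 → Ω → Vec n} {T : ℝ≥0} {τ : Ω → ℝ≥0} (hτ : Measurable τ)
    (hX : AEMeasurable (uncurryReal X) (P.prod volume))
    (hsq : ∫⁻ ω, (⨆ s : Icc (0 : ℝ≥0) T, ‖X s ω‖ₑ ^ 2) ∂P < ∞) :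
    MemLp (uncurryReal X) 2 (controlMeasure P τ T) := by
  have hXm : AEStronglyMeasurable (uncurryReal X) (controlMeasure P τ T) :=
    hX.restrict.aestronglyMeasurable
  have hle : ∀ ω, timeIntegral τ T (fun p => ‖uncurryReal X p‖ₑ ^ 2) ω ≤
      (⨆ s : Icc (0 : ℝ≥0) T, ‖X s ω‖ₑ ^ 2) * T := fun ω =>
    calc timeIntegral τ T (fun p => ‖uncurryReal X p‖ₑ ^ 2) ω
        ≤ ∫⁻ _s in Icc (τ ω : ℝ) T, ⨆ s : Icc (0 : ℝ≥0) T, ‖X s ω‖ₑ ^ 2 :=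
          setLIntegral_mono' measurableSet_Icc fun s hs =>
            le_iSup (fun s : Icc (0 : ℝ≥0) T => ‖X s ω‖ₑ ^ 2)
              ⟨s.toNNReal, zero_le, (toNNReal_mem_Icc hs).2⟩
      _ ≤ (⨆ s : Icc (0 : ℝ≥0) T, ‖X s ω‖ₑ ^ 2) * T := by
          rw [setLIntegral_const, Real.volume_Icc]
          gcongr
          rw [← ENNReal.ofReal_coe_nnreal]
          exact ENNReal.ofReal_le_ofReal (by simp)
  have hfin : eLpNorm (uncurryReal X) 2 (controlMeasure P τ T) ^ 2 ≠ ∞ := by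
    rw [eLpNorm_two_sq, lintegral_controlMeasure hτ (hXm.enorm.pow_const 2)]
    refine ne_top_of_le_ne_top ?_ (lintegral_mono hle)
    rw [lintegral_mul_const' _ _ ENNReal.coe_ne_top]
    exact ENNReal.mul_ne_top hsq.ne ENNReal.coe_ne_top
  exact ⟨hXm, lt_top_iff_ne_top.2 (ENNReal.pow_ne_top_iff.1 hfin |>.resolve_right two_ne_zero)⟩

end ModelAssumptions

end SwingControl

open SwingControl in
theorem lemma1_general {Ω : Type*} {mΩ : MeasurableSpace Ω} {P : Measure Ω} [IsFiniteMeasure P]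
    {n : ℕ} {T : ℝ≥0} {𝓕 : Filtration ℝ≥0 mΩ} {X : ℝ≥0 → Ω → Vec n} {Γ K : Set (Vec n)}
    (hΓ : IsClosed Γ) (hΓc : Convex ℝ Γ) {f : Vec n → Vec n → ℝ≥0 → ℝ} {c C : ℝ}
    (hf : IsCoercivePayoff K f c C) {τ : Ω → ℝ≥0}
    (hτ : IsStoppingTime 𝓕 (fun ω => (τ ω : WithTop ℝ≥0)))
    (hX : MemLp (uncurryReal X) 2 (controlMeasure P τ T))
    {Y : Ω → Vec n} (hY : ∀ᵐ ω ∂P, Y ω ∈ Γ) :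
    ∃ ubar : ℝ≥0 → Ω → Vec n, IsAdmissible P 𝓕 T Γ K τ Y ubar ∧
      IsEssSupFamily P
        {h | ∃ u, IsAdmissible P 𝓕 T Γ K τ Y u ∧
          h = extCondExp hτ.measurableSpace P (payoff f X T τ u)}
        (extCondExp hτ.measurableSpace P (payoff f X T τ ubar)) ∧
      ∀ u, IsAdmissible P 𝓕 T Γ K τ Y u →
        extIntegral P (payoff f X T τ u) ≤ extIntegral P (payoff f X T τ ubar) := by
  have hτm := measurable_of_isStoppingTime hτ
  obtain ⟨ubar, hubar, hfin, hmin⟩ :=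
    hf.exists_isAdmissible_forall_lintegral_totalLoss_le (𝓕 := 𝓕) hτm hX hΓ hΓc hY
  refine ⟨ubar, hubar, ⟨(measurable_extCondExp _ _).mono hτ.measurableSpace_le le_rfl, ?_,
    fun g' _ hg' => hg' _ ⟨ubar, hubar, rfl⟩⟩, fun u hu => ?_⟩
  · rintro _ ⟨u, hu, rfl⟩
    filter_upwards [hf.extCondExp_payoff_ae_eq hτm hX hu hτ.measurableSpace,
      hf.extCondExp_payoff_ae_eq hτm hX hubar hτ.measurableSpace,
      condLExp_le_condLExp_of_forall_lintegral_le hτ (fun u v ω => totalLoss_congr) hubar hfin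
        hmin hu] with ω hω hω_bar hle
    rw [hω, hω_bar]
    exact EReal.sub_le_sub le_rfl (EReal.coe_ennreal_le_coe_ennreal_iff.2 hle)
  · rw [hf.extIntegral_payoff hτm hX hu, hf.extIntegral_payoff hτm hX hubar]
    exact EReal.sub_le_sub le_rfl (EReal.coe_ennreal_le_coe_ennreal_iff.2 (hmin u hu))

theorem lemma1 {Ω : Type*} {mΩ : MeasurableSpace Ω} (P : Measure Ω) [IsProbabilityMeasure P]
    (n : ℕ) (hn : 0 < n) (T : ℝ≥0) (hT : 0 < T)
    (X : ℝ≥0 → Ω → SwingControl.Vec n) (hX : ∀ t, StronglyMeasurable (X t))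
    (hrcll : ∀ᵐ ω ∂P, SwingControl.IsRCLL (fun t => X t ω))
    (hsq : ∫⁻ ω, (⨆ s : Set.Icc (0 : ℝ≥0) T, ‖X s ω‖ₑ ^ 2) ∂P < ∞)
    (hpos : ∀ t i, ∀ᵐ ω ∂P, 0 ≤ X t ω i)
    (Γ₀ : Set (SwingControl.Vec n)) (hΓ₀ : SwingControl.IsConstraintCone Γ₀)
    (g : SwingControl.Vec n) (hg : ∀ i, 0 < g i)
    (K : Set (SwingControl.Vec n))
    (f : SwingControl.Vec n → SwingControl.Vec n → ℝ≥0 → ℝ)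
    (hKf : SwingControl.IsLinearCase K f ∨ SwingControl.IsQuadraticCase K f)
    (τ : Ω → ℝ≥0)
    (hτ : IsStoppingTime (Filtration.natural X hX) (fun ω => (τ ω : WithTop ℝ≥0)))
    (hτT : ∀ ω, τ ω ≤ T)
    (Y : Ω → SwingControl.Vec n) (hY : Measurable[hτ.measurableSpace] Y)
    (hYΓ : ∀ᵐ ω ∂P, Y ω ∈ SwingControl.constraintSet Γ₀ g) :
    ∃ ubar : ℝ≥0 → Ω → SwingControl.Vec n,
      SwingControl.IsAdmissible P (Filtration.natural X hX) T
        (SwingControl.constraintSet Γ₀ g) K τ Y ubar ∧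
      SwingControl.IsEssSupFamily P
        {h | ∃ u, SwingControl.IsAdmissible P (Filtration.natural X hX) T
              (SwingControl.constraintSet Γ₀ g) K τ Y u ∧
            h = SwingControl.extCondExp hτ.measurableSpace P (SwingControl.payoff f X T τ u)}
        (SwingControl.extCondExp hτ.measurableSpace P (SwingControl.payoff f X T τ ubar)) ∧
      ∀ u, SwingControl.IsAdmissible P (Filtration.natural X hX) T
          (SwingControl.constraintSet Γ₀ g) K τ Y u →
        SwingControl.extIntegral P (SwingControl.payoff f X T τ u) ≤
          SwingControl.extIntegral P (SwingControl.payoff f X T τ ubar) := by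
  obtain ⟨c, C, hf⟩ := SwingControl.exists_isCoercivePayoff hKf
  exact lemma1_general (SwingControl.isClosed_constraintSet hΓ₀.isClosed g)
    (SwingControl.convex_constraintSet hΓ₀.convex g) hf hτ
    (SwingControl.memLp_uncurryReal (SwingControl.measurable_of_isStoppingTime hτ)
      (SwingControl.aemeasurable_uncurryReal (fun t => (hX t).measurable)
        (hrcll.mono fun _ hω t => (hω t).1)) hsq) hYΓ
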